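/- Let $\mathcal S,\mathcal A$ be finite sets ($\mathcal A\ne\emptyset$) and consider a Markov decision process in which taking action $a$ in state $s$ produces a random reward and a next state with a given joint law; let $P(s'\mid s,a)$ be the resulting transition probabilities and $R(s,a)=\mathbb E[r(s,a)]$ the mean reward, and suppose $\operatorname{Var}[r(s,a)]<\infty$ for all $(s,a)$. Let $\gamma\in[0,1)$. Two tables $Q^A_t,Q^B_t:\mathcal S\times\mathcal A\to\mathbb R$, with arbitrary (possibly random) initial values $Q^A_0,Q^B_0$, are learned along a trajectory $(s_t,a_t,r_t)_{t\ge 0}$, where $a_t$ is chosen in a non-anticipating way (using the past and possibly extra randomization) and, conditionally on everything known before $(r_t,s_{t+1})$ is observed, $(r_t,s_{t+1})$ has the law of the process at $(s_t,a_t)$. At each time $t$ let $\mathcal M_K$ be a set of $K=K_t$ actions ($1\le K_t\le|\mathcal A|$, possibly varying with $t$ and adaptively chosen) having the top $K$ values of $Q^B_t(s_{t+1},\cdot)$, let $a_K^*\in\arg\max_{a\in\mathcal M_K}Q^A_t(s_{t+1},a)$ and $a^*\in\arg\max_{a\in\mathcal A}Q^A_t(s_{t+1},a)$, ties being broken arbitrarily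 without use of information later than time $t+1$. Put $$y_t=r_t+\gamma\min\{Q^B_t(s_{t+1},a_K^*),\,Q^A_t(s_{t+1},a^*)\}$$ and update both tables simultaneously with this same target, $$Q^A_{t+1}(s_t,a_t)=Q^A_t(s_t,a_t)+\alpha_t(s_t,a_t)\bigl(y_t-Q^A_t(s_t,a_t)\bigr),$$ $$Q^B_{t+1}(s_t,a_t)=Q^B_t(s_t,a_t)+\alpha_t(s_t,a_t)\bigl(y_t-Q^B_t(s_t,a_t)\bigr),$$ all other entries being unchanged. The learning rates $\alpha_t(s,a)$ may be random but depend only on what is known before $(r_t,s_{t+1})$ is observed. Suppose that with probability 1 every pair $(s,a)$ is visited infinitely often, $\alpha_t(s,a)\in[0,1]$, $\sum_t\alpha_t(s,a)=\infty$ and $\sum_t\alpha_t(s,a)^2<\infty$ for all $(s,a)$, and $\alpha_t(s,a)=0$ whenever $(s,a)\ne(s_t,a_t)$. Then the Bellman optimality equation $$Q^*(s,a)=R(s,a)+\gamma\sum_{s'}P(s'\mid s,a)\max_{a'}Q^*(s',a')$$ has a unique solution $Q^*$, and the algorithm converges to the optimal policy: with probability 1, $Q^A_t\to Q^*$ and $Q^B_t\to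 Q^*$ at every $(s,a)$, and for all sufficiently large $t$ every policy that is greedy with respect to $Q^A_t$ or to $Q^B_t$ is an optimal policy, i.e. satisfies $\pi(s)\in\arg\max_aQ^*(s,a)$ for all $s$. -/

import Mathlib

open MeasureTheory Filter Topology

/-- A Markov decision process with state space `S` and action space `A`, given by the joint law
`law s a` of (random reward, next state) when action `a` is taken in state `s`. -/
structure MDP (S A : Type*) [MeasurableSpace S] where
  law : S → A → Measure (ℝ × S)
  isProbabilityMeasure_law : ∀ s a, IsProbabilityMeasure (law s a)

namespace MDP

variable {S A : Type*} [MeasurableSpace S]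

/-- The probability of moving to `s'` after taking action `a` in state `s`. -/
noncomputable def transition (M : MDP S A) (s : S) (a : A) (s' : S) : ℝ :=
  (M.law s a).real {p | p.2 = s'}

/-- The reward function: the mean of the random reward of `a` in `s`. -/
noncomputable def reward (M : MDP S A) (s : S) (a : A) : ℝ :=
  ∫ p, p.1 ∂(M.law s a)

/-- `Q` solves the Bellman optimality equation of the finite MDP `M` with discount factor `γ`. -/
def IsOptimalQ [Fintype S] [Fintype A] [Nonempty A] (M : MDP S A) (γ : ℝ) (Q : S → A → ℝ) :
    Prop :=
  ∀ s a, Q s a = M.reward s a + γ * ∑ s', M.transition s a s' *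
    Finset.univ.sup' Finset.univ_nonempty (fun a' => Q s' a')

end MDP

/-- The policy `π` picks in every state an action that maximizes `Q`. For the optimal action value
function `Q` this says that `π` is an optimal policy. -/
def IsGreedyPolicy {S A : Type*} (Q : S → A → ℝ) (π : S → A) : Prop :=
  ∀ s a, Q s a ≤ Q s (π s)

/-- `C` is a set of `K` actions that have the top `K` values of `q` (ties broken arbitrarily). -/
def IsTopCandidates {A : Type*} (q : A → ℝ) (K : ℕ) (C : Finset A) : Prop :=
  C.card = K ∧ ∀ a ∈ C, ∀ b ∉ C, q b ≤ q a

/-- A run, on a filtered probability space, of action candidate based clipped double Q-learning with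
simultaneous updating, for the MDP `M` and the discount factor `γ`. The σ-algebra `ℱ t` is the
information available just before the reward `r t` and the next state `s (t + 1)` are observed. -/
structure SimultaneousRun {S A Ω : Type*} [MeasurableSpace S] [MeasurableSpace A]
    [mΩ : MeasurableSpace Ω] (M : MDP S A) (γ : ℝ) (μ : Measure Ω) where
  ℱ : Filtration ℕ mΩ
  /-- state at time `t` -/
  s : ℕ → Ω → S
  /-- action at time `t`, chosen in any non-anticipating way -/
  a : ℕ → Ω → A
  /-- reward received at time `t` -/
  r : ℕ → Ω → ℝ
  /-- learning rates -/
  α : ℕ → Ω → S → A → ℝ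
  /-- number of action candidates at time `t`, possibly random and adaptive -/
  K : ℕ → Ω → ℕ
  /-- set of action candidates at time `t` -/
  candidates : ℕ → Ω → Finset A
  /-- the action `a_K^*` at time `t` -/
  aK : ℕ → Ω → A
  /-- the action `a^*` at time `t` -/
  aStar : ℕ → Ω → A
  QA : ℕ → Ω → S → A → ℝ
  QB : ℕ → Ω → S → A → ℝ
  measurable_s : ∀ t, Measurable[ℱ t] (s t)
  measurable_a : ∀ t, Measurable[ℱ t] (a t)
  measurable_r : ∀ t, Measurable[ℱ (t + 1)] (r t)
  measurable_α : ∀ t x u, Measurable[ℱ t] (fun ω => α t ω x u)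
  measurable_aK : ∀ t, Measurable[ℱ (t + 1)] (aK t)
  measurable_QA_zero : ∀ x u, Measurable[ℱ 0] (fun ω => QA 0 ω x u)
  measurable_QB_zero : ∀ x u, Measurable[ℱ 0] (fun ω => QB 0 ω x u)
  /-- Given the past, reward and next state are drawn from the law of the MDP at `(s t, a t)`. -/
  markov : ∀ t, ∀ B : Set (ℝ × S), MeasurableSet B →
    μ[((fun ω => (r t ω, s (t + 1) ω)) ⁻¹' B).indicator (fun _ => (1 : ℝ)) | ℱ t]
      =ᵐ[μ] fun ω => (M.law (s t ω) (a t ω)).real B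
  one_le_K : ∀ t ω, 1 ≤ K t ω
  /-- The candidates are top `K` actions for `QB` in the next state. -/
  isTopCandidates : ∀ t ω,
    IsTopCandidates (QB t ω (s (t + 1) ω)) (K t ω) (candidates t ω)
  /-- `a_K^*` maximizes `QA` in the next state among the candidates. -/
  aK_mem : ∀ t ω, aK t ω ∈ candidates t ω
  aK_max : ∀ t ω, ∀ u ∈ candidates t ω,
    QA t ω (s (t + 1) ω) u ≤ QA t ω (s (t + 1) ω) (aK t ω)
  /-- `a^*` maximizes `QA` in the next state among all actions. -/
  aStar_max : ∀ t ω u,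
    QA t ω (s (t + 1) ω) u ≤ QA t ω (s (t + 1) ω) (aStar t ω)
  /-- Both tables are updated at `(s t, a t)` with the same target. -/
  QA_update : ∀ t ω, QA (t + 1) ω (s t ω) (a t ω) = QA t ω (s t ω) (a t ω) +
    α t ω (s t ω) (a t ω) *
      ((r t ω + γ * min (QB t ω (s (t + 1) ω) (aK t ω)) (QA t ω (s (t + 1) ω) (aStar t ω)))
        - QA t ω (s t ω) (a t ω))
  QB_update : ∀ t ω, QB (t + 1) ω (s t ω) (a t ω) = QB t ω (s t ω) (a t ω) +
    α t ω (s t ω) (a t ω) *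
      ((r t ω + γ * min (QB t ω (s (t + 1) ω) (aK t ω)) (QA t ω (s (t + 1) ω) (aStar t ω)))
        - QB t ω (s t ω) (a t ω))
  QA_unchanged : ∀ t ω x u, (x, u) ≠ (s t ω, a t ω) → QA (t + 1) ω x u = QA t ω x u
  QB_unchanged : ∀ t ω x u, (x, u) ≠ (s t ω, a t ω) → QB (t + 1) ω x u = QB t ω x u

/-! Both tables move toward the same target with the same step size, so at every pair their
difference is only multiplied by `1 - α`. As the steps have infinite sum, it tends to zero along
each outcome, whatever the rewards are (`tendsto_tableDiff`). The clipped value differs from the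
maximum of `QA` by at most three times this difference (`abs_clipped_sub_maxValue_le`). Hence `QA`
performs ordinary Q-learning with a vanishing bias.

What remains is stochastic approximation for the Bellman operator, a `γ`-contraction in the sup
norm. Subtracting from `QA` the running average of the noise leaves a recursion without noise of its
own, to which `tendsto_zero_of_contraction` applies. The averaged noise vanishes if the series of
step times noise converges (`tendsto_averagedNoise`), and martingale convergence provides this
(`ae_exists_tendsto_sum_mul`).

The transition noise is weighted by the maxima of `QA`, so its series is controlled only once `QA`
is known to be bounded. Boundedness is therefore proved first, removing the reward noise alone
(`exists_abs_QA_le`); convergence then uses both noises (`tendsto_QA`). -/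

/-! ### Averaging recursions with step sizes of infinite sum. -/

/-- A sequence that is repeatedly averaged with a constant `c`, with step sizes of infinite sum, is
eventually at most `c + ε`. -/
theorem eventually_le_of_averaging {α u : ℕ → ℝ} {c ε : ℝ}
    (hα : ∀ t, α t ∈ Set.Icc (0 : ℝ) 1)
    (hsum : Tendsto (fun n => ∑ t ∈ Finset.range n, α t) atTop atTop)
    (hu : ∀ᶠ t in atTop, u (t + 1) ≤ (1 - α t) * u t + α t * c) (hε : 0 < ε) :
    ∀ᶠ t in atTop, u t ≤ c + ε := by
  obtain ⟨T, hT⟩ := eventually_atTop.1 hu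
  set σ : ℕ → ℝ := fun n => ∑ t ∈ Finset.range n, α t with hσ
  -- The excess over `c` shrinks by `1 - α t ≤ exp (-α t)`. The absolute value keeps the bound
  -- nonnegative, as this comparison of factors requires.
  have key : ∀ t ≥ T, u t - c ≤ Real.exp (σ T - σ t) * |u T - c| := by
    intro t ht
    induction t, ht using Nat.le_induction with
    | base => simpa using le_abs_self (u T - c)
    | succ t ht ih =>
      have h1 : u (t + 1) - c ≤ (1 - α t) * (u t - c) := by linarith [hT t ht]
      have h2 : 1 - α t ≤ Real.exp (-α t) := by linarith [Real.add_one_le_exp (-α t)]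
      have h3 : σ T - σ (t + 1) = -α t + (σ T - σ t) := by
        simp only [hσ, Finset.sum_range_succ]; ring
      calc u (t + 1) - c ≤ (1 - α t) * (u t - c) := h1
        _ ≤ (1 - α t) * (Real.exp (σ T - σ t) * |u T - c|) :=
            mul_le_mul_of_nonneg_left ih (by linarith [(hα t).2])
        _ ≤ Real.exp (-α t) * (Real.exp (σ T - σ t) * |u T - c|) :=
            mul_le_mul_of_nonneg_right h2 (by positivity)
        _ = _ := by rw [h3, Real.exp_add]; ring
  have hlim : Tendsto (fun t => Real.exp (σ T - σ t) * |u T - c|) atTop (𝓝 0) := by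
    have h : Tendsto (fun t => σ T - σ t) atTop atBot :=
      tendsto_atBot_add_const_left _ _ (tendsto_neg_atTop_atBot.comp hsum)
    simpa using (Real.tendsto_exp_atBot.comp h).mul_const |u T - c|
  filter_upwards [eventually_ge_atTop T, hlim.eventually (gt_mem_nhds hε)] with t ht h
  linarith [key t ht]

theorem tendsto_zero_of_averaging {α b u : ℕ → ℝ} (hα : ∀ t, α t ∈ Set.Icc (0 : ℝ) 1)
    (hsum : Tendsto (fun n => ∑ t ∈ Finset.range n, α t) atTop atTop)
    (hu : ∀ t, u (t + 1) = (1 - α t) * u t + α t * b t) (hb : Tendsto b atTop (𝓝 0)) :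
    Tendsto u atTop (𝓝 0) := by
  rw [Metric.tendsto_atTop']
  intro ε hε
  have hb' : ∀ᶠ t in atTop, |b t| < ε / 4 := by
    simpa using hb.abs.eventually (gt_mem_nhds (by simpa using (by positivity : 0 < ε / 4)))
  have h := eventually_le_of_averaging (u := fun t => |u t|) (c := ε / 4) (ε := ε / 4) hα hsum
    (by
      filter_upwards [hb'] with t ht
      rw [hu]
      have h0 := (hα t).1
      have h1 : 0 ≤ 1 - α t := by linarith [(hα t).2]
      calc |(1 - α t) * u t + α t * b t| ≤ |(1 - α t) * u t| + |α t * b t| := abs_add_le _ _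
        _ = (1 - α t) * |u t| + α t * |b t| := by
            rw [abs_mul, abs_mul, abs_of_nonneg h0, abs_of_nonneg h1]
        _ ≤ _ := by gcongr) (by positivity)
  obtain ⟨T, hT⟩ := eventually_atTop.1 h
  refine ⟨T, fun t ht => ?_⟩
  rw [Real.dist_0_eq_abs]
  have := hT t ht.le
  linarith

/-- Exponentially averaged noise: `averagedNoise α ξ (t + 1)` averages the noise `ξ t` with the
previous value, with step size `α t`. -/
noncomputable def averagedNoise (α ξ : ℕ → ℝ) : ℕ → ℝ
  | 0 => 0
  | t + 1 => (1 - α t) * averagedNoise α ξ t + α t * ξ t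

/-- Averaged noise vanishes as soon as the series of the weighted noise converges. -/
theorem tendsto_averagedNoise {α ξ : ℕ → ℝ} (hα : ∀ t, α t ∈ Set.Icc (0 : ℝ) 1)
    (hsum : Tendsto (fun n => ∑ t ∈ Finset.range n, α t) atTop atTop)
    (hξ : ∃ c, Tendsto (fun n => ∑ t ∈ Finset.range n, α t * ξ t) atTop (𝓝 c)) :
    Tendsto (averagedNoise α ξ) atTop (𝓝 0) := by
  obtain ⟨c, hc⟩ := hξ
  set σ : ℕ → ℝ := fun n => ∑ t ∈ Finset.range n, α t * ξ t with hσ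
  have hc' : Tendsto (fun t => c - σ t) atTop (𝓝 0) := by
    simpa using (tendsto_const_nhds (x := c)).sub hc
  -- Adding the tail of the series cancels the noise term: the sum is an averaging recursion whose
  -- input is the tail itself, which tends to zero.
  have h := tendsto_zero_of_averaging (u := fun t => averagedNoise α ξ t + (c - σ t))
    (b := fun t => c - σ t) hα hsum
    (by
      intro t
      simp only [averagedNoise, hσ, Finset.sum_range_succ]
      ring) hc'
  simpa using h.sub hc'

/-! ### Asynchronous contractions in the sup norm. -/

section Contraction

variable {ι : Type*} [Fintype ι] {γ : ℝ} {α z : ℕ → ι → ℝ} {δ : ℕ → ℝ}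

theorem exists_norm_le_of_contraction (hγ1 : γ < 1)
    (hα : ∀ t i, α t i ∈ Set.Icc (0 : ℝ) 1)
    (hz : ∀ t i, |z (t + 1) i| ≤ (1 - α t i) * |z t i| + α t i * (γ * ‖z t‖ + δ t))
    (hγ0 : 0 ≤ γ) {B : ℝ} (hδ : ∀ t, δ t ≤ B) : ∃ C, ∀ t, ‖z t‖ ≤ C := by
  -- The ball of radius `C` is invariant, since `C ≥ B / (1 - γ)` means `γ * C + B ≤ C`.
  set C := max ‖z 0‖ (B / (1 - γ))
  have hC : γ * C + B ≤ C := by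
    have h : B / (1 - γ) ≤ C := le_max_right _ _
    rw [div_le_iff₀ (by linarith)] at h
    linarith
  have hC0 : 0 ≤ C := (norm_nonneg _).trans (le_max_left _ _)
  refine ⟨C, fun t => ?_⟩
  induction t with
  | zero => exact le_max_left _ _
  | succ t ih =>
    refine (pi_norm_le_iff_of_nonneg hC0).2 fun i => ?_
    have h0 := (hα t i).1
    have h1 : 0 ≤ 1 - α t i := by linarith [(hα t i).2]
    have h2 : |z t i| ≤ C := (norm_le_pi_norm (z t) i).trans ih
    have h3 : γ * ‖z t‖ + δ t ≤ C :=
      (add_le_add (mul_le_mul_of_nonneg_left ih hγ0) (hδ t)).trans hC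
    calc |z (t + 1) i| ≤ _ := hz t i
      _ ≤ (1 - α t i) * C + α t i * C := by gcongr
      _ = C := by ring

/-- Any eventual bound `c` on the norm improves to `γ * c + ε`, because each coordinate is averaged
with inputs that are eventually about `γ * c` at most. Iterating drives the bound down to the fixed
point `ε / (1 - γ)`, which is arbitrarily small. -/
theorem tendsto_zero_of_contraction (hγ1 : γ < 1)
    (hα : ∀ t i, α t i ∈ Set.Icc (0 : ℝ) 1)
    (hsum : ∀ i, Tendsto (fun n => ∑ t ∈ Finset.range n, α t i) atTop atTop)
    (hz : ∀ t i, |z (t + 1) i| ≤ (1 - α t i) * |z t i| + α t i * (γ * ‖z t‖ + δ t))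
    (hγ0 : 0 ≤ γ) (hδ : Tendsto δ atTop (𝓝 0)) : Tendsto z atTop (𝓝 0) := by
  obtain ⟨B, hB⟩ := hδ.bddAbove_range
  obtain ⟨C, hC⟩ := exists_norm_le_of_contraction hγ1 hα hz hγ0
    (fun t => hB (Set.mem_range_self t))
  have step : ∀ c, 0 ≤ c → ∀ ε > 0, (∀ᶠ t in atTop, ‖z t‖ ≤ c) →
      ∀ᶠ t in atTop, ‖z t‖ ≤ γ * c + ε := by
    intro c hc ε hε h
    have hi : ∀ i, ∀ᶠ t in atTop, |z t i| ≤ (γ * c + ε / 2) + ε / 2 := by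
      intro i
      refine eventually_le_of_averaging (u := fun t => |z t i|) (fun t => hα t i) (hsum i) ?_
        (by positivity)
      filter_upwards [h, hδ.eventually (gt_mem_nhds (by positivity : 0 < ε / 2))] with t h1 h2
      have h0 := (hα t i).1
      refine (hz t i).trans ?_
      gcongr
    filter_upwards [eventually_all.2 hi] with t ht
    refine (pi_norm_le_iff_of_nonneg (by positivity)).2 fun i => ?_
    rw [Real.norm_eq_abs]
    linarith [ht i]
  have iter : ∀ ε > 0, ∀ k : ℕ, ∀ᶠ t in atTop, ‖z t‖ ≤ γ ^ k * |C| + ε / (1 - γ) := by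
    intro ε hε k
    have hg : 0 < 1 - γ := by linarith
    induction k with
    | zero =>
      refine .of_forall fun t => (hC t).trans ?_
      have : 0 ≤ ε / (1 - γ) := by positivity
      linarith [le_abs_self C, pow_zero γ, one_mul |C|]
    | succ k ih =>
      filter_upwards [step _ (by positivity) ε hε ih] with t ht
      refine ht.trans (le_of_eq ?_)
      field_simp
      ring
  rw [tendsto_zero_iff_norm_tendsto_zero, Metric.tendsto_atTop']
  intro ε hε
  have hg : 0 < 1 - γ := by linarith
  have hpow : Tendsto (fun k : ℕ => γ ^ k * |C|) atTop (𝓝 0) := by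
    simpa using (tendsto_pow_atTop_nhds_zero_of_lt_one hγ0 hγ1).mul_const |C|
  obtain ⟨k, hk⟩ := (hpow.eventually (gt_mem_nhds (by positivity : 0 < ε / 2))).exists
  obtain ⟨T, hT⟩ := eventually_atTop.1 (iter (ε / 4 * (1 - γ)) (by positivity) k)
  refine ⟨T, fun t ht => ?_⟩
  have := hT t ht.le
  rw [mul_div_assoc, div_self hg.ne', mul_one] at this
  rw [Real.dist_0_eq_abs, abs_of_nonneg (norm_nonneg _)]
  linarith

end Contraction

/-! ### Almost sure convergence of martingale transforms. -/

section MartingaleTransform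

variable {Ω : Type*} [mΩ : MeasurableSpace Ω] {μ : Measure Ω} [IsProbabilityMeasure μ]
  {ℱ : Filtration ℕ mΩ} {ξ β : ℕ → Ω → ℝ} {C : ℝ}

/-- Increments of a martingale are orthogonal, so the second moments of the partial sums are at most
`C * N`. The martingale is then bounded in `L¹` and Doob's convergence theorem applies. -/
theorem ae_exists_tendsto_sum_mul_of_bdd
    (hξm : ∀ t, Measurable[ℱ (t + 1)] (ξ t)) (hξ : ∀ t, MemLp (ξ t) 2 μ)
    (hξ0 : ∀ t, μ[ξ t | ℱ t] =ᵐ[μ] 0) (hC : ∀ t, μ[ξ t ^ 2 | ℱ t] ≤ᵐ[μ] fun _ => C)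
    (hβm : ∀ t, Measurable[ℱ t] (β t)) {N : ℝ}
    (hβ : ∀ ω n, ∑ t ∈ Finset.range n, β t ω ^ 2 ≤ N) :
    ∀ᵐ ω ∂μ, ∃ c, Tendsto (fun n => ∑ t ∈ Finset.range n, β t ω * ξ t ω) atTop (𝓝 c) := by
  have hβN : ∀ t ω, β t ω ^ 2 ≤ N := fun t ω =>
    (Finset.single_le_sum (f := fun t => β t ω ^ 2) (fun i _ => sq_nonneg _)
      (Finset.self_mem_range_succ t)).trans (hβ ω (t + 1))
  have hβb : ∀ t, ∀ᵐ ω ∂μ, ‖β t ω‖ ≤ √N := fun t => .of_forall fun ω =>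
    Real.abs_le_sqrt (hβN t ω)
  have hβsm : ∀ t, StronglyMeasurable[ℱ t] (β t) := fun t => (hβm t).stronglyMeasurable
  have hβae : ∀ t, AEStronglyMeasurable (β t) μ := fun t =>
    ((hβsm t).mono (ℱ.le t)).aestronglyMeasurable
  have hinc : ∀ t, MemLp (β t * ξ t) 2 μ := fun t =>
    (hξ t).mul (memLp_top_of_bound (hβae t) _ (hβb t))
  set M : ℕ → Ω → ℝ := fun n => ∑ t ∈ Finset.range n, β t * ξ t with hM
  have hML2 : ∀ n, MemLp (M n) 2 μ := fun n => memLp_finsetSum' _ fun t _ => hinc t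
  have hMsm : ∀ n, StronglyMeasurable[ℱ n] (M n) := fun n =>
    Finset.stronglyMeasurable_sum _ fun t ht =>
      ((hβsm t).mono (ℱ.mono (Finset.mem_range.1 ht).le)).mul
        ((hξm t).stronglyMeasurable.mono (ℱ.mono (Finset.mem_range.1 ht)))
  have hMint : ∀ n, Integrable (M n) μ := fun n => (hML2 n).integrable one_le_two
  have hsucc : ∀ n, M (n + 1) = M n + β n * ξ n := fun n => Finset.sum_range_succ _ n
  have hmart : Martingale M ℱ μ := by
    refine martingale_of_condExp_sub_eq_zero_nat hMsm hMint fun n => ?_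
    rw [hsucc, add_sub_cancel_left]
    filter_upwards [condExp_mul_of_stronglyMeasurable_left (hβsm n)
      ((hinc n).integrable one_le_two) ((hξ n).integrable one_le_two), hξ0 n] with ω h1 h2
    simp [h1, h2]
  have hcross : ∀ n, ∫ ω, M n ω * (β n ω * ξ n ω) ∂μ = 0 := by
    intro n
    have hint : Integrable ((M n * β n) * ξ n) μ := by
      rw [mul_assoc]; exact (hML2 n).integrable_mul (hinc n)
    have h := condExp_mul_of_stronglyMeasurable_left ((hMsm n).mul (hβsm n)) hint
      ((hξ n).integrable one_le_two)
    calc ∫ ω, M n ω * (β n ω * ξ n ω) ∂μ = ∫ ω, ((M n * β n) * ξ n) ω ∂μ := by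
          simp [mul_assoc]
      _ = ∫ ω, (μ[(M n * β n) * ξ n | ℱ n]) ω ∂μ := (integral_condExp (ℱ.le n)).symm
      _ = ∫ ω, (0 : ℝ) ∂μ := by
          refine integral_congr_ae ?_
          filter_upwards [h, hξ0 n] with ω h1 h2
          simp [h1, h2]
      _ = 0 := by simp
  have hβ2b : ∀ t, ∀ᵐ ω ∂μ, ‖(β t ^ 2) ω‖ ≤ N := fun t => .of_forall fun ω => by
    simpa [abs_of_nonneg (sq_nonneg (β t ω))] using hβN t ω
  have hβ2 : ∀ t, Integrable (β t ^ 2) μ := fun t =>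
    Integrable.of_bound ((hβae t).pow 2) N (hβ2b t)
  have hsq : ∀ n, ∫ ω, (β n ω * ξ n ω) ^ 2 ∂μ ≤ C * ∫ ω, β n ω ^ 2 ∂μ := by
    intro n
    have h := condExp_stronglyMeasurable_mul_of_bound (μ := μ) (ℱ.le n) ((hβsm n).pow 2)
      (hξ n).integrable_sq N (hβ2b n)
    calc ∫ ω, (β n ω * ξ n ω) ^ 2 ∂μ = ∫ ω, (β n ^ 2 * fun ω => ξ n ω ^ 2) ω ∂μ := by
          simp [mul_pow]
      _ = ∫ ω, (μ[β n ^ 2 * fun ω => ξ n ω ^ 2 | ℱ n]) ω ∂μ := (integral_condExp (ℱ.le n)).symm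
      _ ≤ ∫ ω, C * β n ω ^ 2 ∂μ := by
          refine integral_mono_ae integrable_condExp ((hβ2 n).const_mul C) ?_
          filter_upwards [h, hC n] with ω h1 h2
          rw [h1, mul_comm C]
          exact mul_le_mul_of_nonneg_left h2 (sq_nonneg _)
      _ = _ := integral_const_mul _ _
  have hbound : ∀ n, ∫ ω, M n ω ^ 2 ∂μ ≤ C * ∑ t ∈ Finset.range n, ∫ ω, β t ω ^ 2 ∂μ := by
    intro n
    induction n with
    | zero => simp [hM]
    | succ n ih =>
      have h : ∫ ω, M (n + 1) ω ^ 2 ∂μ = ∫ ω, M n ω ^ 2 ∂μ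
          + 2 * ∫ ω, M n ω * (β n ω * ξ n ω) ∂μ + ∫ ω, (β n ω * ξ n ω) ^ 2 ∂μ := by
        have i1 := (hML2 n).integrable_sq
        have i2 : Integrable (fun ω => M n ω * (β n ω * ξ n ω)) μ :=
          (hML2 n).integrable_mul (hinc n)
        have i3 : Integrable (fun ω => (β n ω * ξ n ω) ^ 2) μ := (hinc n).integrable_sq
        have i12 : Integrable (fun ω => M n ω ^ 2 + 2 * (M n ω * (β n ω * ξ n ω))) μ :=
          i1.add (i2.const_mul 2)
        rw [← integral_const_mul, ← integral_add i1 (i2.const_mul 2), ← integral_add i12 i3]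
        refine integral_congr_ae (.of_forall fun ω => ?_)
        simp only [hsucc, Pi.add_apply, Pi.mul_apply]
        ring
      rw [h, hcross, Finset.sum_range_succ, mul_add]
      linarith [hsq n]
  have hC0 : 0 ≤ C := by
    -- A conditional second moment is nonnegative, and a probability measure has a point where both
    -- almost sure bounds hold.
    have h : ∀ᵐ ω ∂μ, 0 ≤ C := by
      filter_upwards [hC 0, condExp_nonneg (μ := μ) (m := ℱ 0) (f := ξ 0 ^ 2)
        (.of_forall fun ω => sq_nonneg (ξ 0 ω))] with ω h1 h2
      exact h2.trans h1
    exact h.exists.choose_spec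
  have hbound' : ∀ n, ∫ ω, M n ω ^ 2 ∂μ ≤ C * N := by
    intro n
    refine (hbound n).trans (mul_le_mul_of_nonneg_left ?_ hC0)
    calc ∑ t ∈ Finset.range n, ∫ ω, β t ω ^ 2 ∂μ
        = ∫ ω, ∑ t ∈ Finset.range n, (β t ^ 2) ω ∂μ :=
          (integral_finsetSum _ fun t _ => hβ2 t).symm
      _ ≤ ∫ ω, N ∂μ :=
          integral_mono (integrable_finsetSum _ fun t _ => hβ2 t) (integrable_const N)
            fun ω => hβ ω n
      _ = N := by simp
  have hL1 : ∀ n, eLpNorm (M n) 1 μ ≤ (1 + C * N).toNNReal := by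
    intro n
    rw [eLpNorm_one_eq_lintegral_enorm, ← ofReal_integral_norm_eq_lintegral_enorm (hMint n)]
    refine ENNReal.ofReal_le_ofReal ?_
    calc ∫ ω, ‖M n ω‖ ∂μ ≤ ∫ ω, (1 + M n ω ^ 2) ∂μ := by
          refine integral_mono (hMint n).norm ((integrable_const 1).add (hML2 n).integrable_sq) ?_
          intro ω
          simp only [Real.norm_eq_abs]
          nlinarith [sq_nonneg (|M n ω| - 1), sq_abs (M n ω), abs_nonneg (M n ω)]
      _ = 1 + ∫ ω, M n ω ^ 2 ∂μ := by
          rw [integral_add (integrable_const 1) (hML2 n).integrable_sq]; simp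
      _ ≤ _ := by linarith [hbound' n]
  filter_upwards [hmart.submartingale.exists_ae_tendsto_of_bdd hL1] with ω h
  simpa [hM] using h

/-- A martingale transform converges almost surely if the conditional second moments of the
increments are bounded and the predictable weights are square summable almost surely. -/
theorem ae_exists_tendsto_sum_mul
    (hξm : ∀ t, Measurable[ℱ (t + 1)] (ξ t)) (hξ : ∀ t, MemLp (ξ t) 2 μ)
    (hξ0 : ∀ t, μ[ξ t | ℱ t] =ᵐ[μ] 0) (hC : ∀ t, μ[ξ t ^ 2 | ℱ t] ≤ᵐ[μ] fun _ => C)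
    (hβm : ∀ t, Measurable[ℱ t] (β t)) (hβ : ∀ᵐ ω ∂μ, Summable fun t => β t ω ^ 2) :
    ∀ᵐ ω ∂μ, ∃ c, Tendsto (fun n => ∑ t ∈ Finset.range n, β t ω * ξ t ω) atTop (𝓝 c) := by
  classical
  -- Localization: weights are switched off once their sum of squares would exceed `N`. The sum
  -- includes `β t`, which is already known at time `t`, so the cutoff is predictable and never
  -- overshoots. Almost every outcome lies in all `G N t` for some `N`.
  let G : ℕ → ℕ → Set Ω := fun N t => {ω | ∑ k ∈ Finset.range (t + 1), β k ω ^ 2 ≤ N}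
  have hG : ∀ N t, MeasurableSet[ℱ t] (G N t) := by
    intro N t
    refine measurableSet_le (mδ := ℱ t) ?_ measurable_const
    exact Finset.measurable_sum _ fun k hk =>
      ((hβm k).mono (ℱ.mono (Nat.lt_succ_iff.1 (Finset.mem_range.1 hk))) le_rfl).pow_const 2
  have hN : ∀ N : ℕ, ∀ᵐ ω ∂μ, ∃ c,
      Tendsto (fun n => ∑ t ∈ Finset.range n, (G N t).indicator (β t) ω * ξ t ω) atTop (𝓝 c) := by
    intro N
    refine ae_exists_tendsto_sum_mul_of_bdd (N := N) hξm hξ hξ0 hC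
      (fun t => (hβm t).indicator (hG N t)) fun ω n => ?_
    induction n with
    | zero => simp
    | succ n ih =>
      by_cases h : ω ∈ G N n
      · refine (Finset.sum_le_sum fun t _ => ?_).trans h
        by_cases h' : ω ∈ G N t
        · rw [Set.indicator_of_mem h']
        · rw [Set.indicator_of_notMem h']; simpa using sq_nonneg (β t ω)
      · rw [Finset.sum_range_succ, Set.indicator_of_notMem h]
        simpa using ih
  filter_upwards [ae_all_iff.2 hN, hβ] with ω h hs
  obtain ⟨N, hN⟩ := exists_nat_ge (∑' t, β t ω ^ 2)
  have hmem : ∀ t, ω ∈ G N t := fun t =>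
    (hs.sum_le_tsum _ fun i _ => sq_nonneg _).trans hN
  simpa [Set.indicator_of_mem (hmem _)] using h N

end MartingaleTransform

/-! ### Conditional expectations from a finite family of conditional laws. -/

section ConditionalLaw

variable {Ω E J : Type*} {m : MeasurableSpace Ω} [mΩ : MeasurableSpace Ω] [MeasurableSpace E]
  {μ : Measure Ω} [IsProbabilityMeasure μ]
  {X : Ω → E} {j : Ω → J} {κ : J → Measure E} [∀ i, IsProbabilityMeasure (κ i)]

/-- Cutting `Ω` along the finitely many values of `j` turns the conditional law into honest image
measures. Integrability and integrals of general functions can then be transferred directly. -/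
theorem map_restrict_eq_smul (hm : m ≤ mΩ) (hX : Measurable X)
    (hκ : ∀ B, MeasurableSet B →
      μ[(X ⁻¹' B).indicator (fun _ => (1 : ℝ)) | m] =ᵐ[μ] fun ω => (κ (j ω)).real B)
    {G : Set Ω} (hG : MeasurableSet[m] G) {i : J} (hi : ∀ ω ∈ G, j ω = i) :
    (μ.restrict G).map X = μ G • κ i := by
  ext B hB
  have hXB := hX hB
  have h : μ.real (X ⁻¹' B ∩ G) = μ.real G * (κ i).real B := by
    calc μ.real (X ⁻¹' B ∩ G) = ∫ ω in G, (X ⁻¹' B).indicator (fun _ => (1 : ℝ)) ω ∂μ := by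
          rw [setIntegral_indicator hXB]; simp [Set.inter_comm]
      _ = ∫ ω in G, (μ[(X ⁻¹' B).indicator (fun _ => (1 : ℝ)) | m]) ω ∂μ :=
          (setIntegral_condExp hm ((integrable_const (1 : ℝ)).indicator hXB) hG).symm
      _ = ∫ ω in G, (κ (j ω)).real B ∂μ :=
          setIntegral_congr_ae (hm _ hG) (by filter_upwards [hκ B hB] with ω h _ using h)
      _ = ∫ ω in G, (κ i).real B ∂μ :=
          setIntegral_congr_fun (hm _ hG) fun ω hω => by simp only [hi ω hω]
      _ = _ := by simp
  rw [Measure.map_apply hX hB, Measure.restrict_apply hXB, Measure.smul_apply, smul_eq_mul,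
    ← ENNReal.toReal_eq_toReal_iff' (by finiteness) (by finiteness), ENNReal.toReal_mul]
  exact h

variable [Fintype J] [MeasurableSpace J] [MeasurableSingletonClass J]

theorem integrable_comp_of_conditionalLaw (hm : m ≤ mΩ) (hX : Measurable X)
    (hj : Measurable[m] j)
    (hκ : ∀ B, MeasurableSet B →
      μ[(X ⁻¹' B).indicator (fun _ => (1 : ℝ)) | m] =ᵐ[μ] fun ω => (κ (j ω)).real B)
    {f : E → ℝ} (hf : ∀ i, Integrable f (κ i)) :
    Integrable (fun ω => f (X ω)) μ := by
  have h : IntegrableOn (fun ω => f (X ω)) (⋃ i, j ⁻¹' {i}) μ := by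
    refine integrableOn_finite_iUnion.2 fun i => ?_
    have h1 := map_restrict_eq_smul hm hX hκ (hj (measurableSet_singleton i))
      (fun ω hω => hω)
    have h2 : Integrable f ((μ.restrict (j ⁻¹' {i})).map X) := by
      rw [h1]; exact (hf i).smul_measure (by finiteness)
    exact h2.comp_measurable hX
  rwa [← Set.preimage_iUnion, Set.iUnion_of_singleton, Set.preimage_univ,
    integrableOn_univ] at h

/-- If `κ (j ω)` is the conditional law of `X` given `m`, the conditional expectation of a function
of `X` is its integral under `κ (j ω)`. -/
theorem condExp_comp_of_conditionalLaw (hm : m ≤ mΩ) (hX : Measurable X)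
    (hj : Measurable[m] j)
    (hκ : ∀ B, MeasurableSet B →
      μ[(X ⁻¹' B).indicator (fun _ => (1 : ℝ)) | m] =ᵐ[μ] fun ω => (κ (j ω)).real B)
    {f : E → ℝ} (hf : ∀ i, Integrable f (κ i)) :
    μ[fun ω => f (X ω) | m] =ᵐ[μ] fun ω => ∫ e, f e ∂(κ (j ω)) := by
  have hint := integrable_comp_of_conditionalLaw hm hX hj hκ hf
  have hgm : Measurable[m] fun ω => ∫ e, f e ∂(κ (j ω)) :=
    (measurable_of_finite fun i => ∫ e, f e ∂(κ i)).comp hj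
  have hgint : Integrable (fun ω => ∫ e, f e ∂(κ (j ω))) μ := by
    refine Integrable.of_bound (hgm.mono hm le_rfl).aestronglyMeasurable
      (∑ i, |∫ e, f e ∂(κ i)|) (.of_forall fun ω => ?_)
    exact Finset.single_le_sum (f := fun i => |∫ e, f e ∂(κ i)|) (fun i _ => abs_nonneg _)
      (Finset.mem_univ (j ω))
  refine (ae_eq_condExp_of_forall_setIntegral_eq hm hint (fun _ _ _ => hgint.integrableOn)
    (fun G hG _ => ?_) hgm.aestronglyMeasurable).symm
  have hGi : ∀ i, MeasurableSet[m] (G ∩ j ⁻¹' {i}) := fun i =>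
    hG.inter (hj (measurableSet_singleton i))
  have hU : G = ⋃ i, G ∩ j ⁻¹' {i} := by
    ext ω; simp
  have hdisj : Pairwise (Function.onFun Disjoint fun i => G ∩ j ⁻¹' {i}) := by
    intro i i' hne
    refine Set.disjoint_left.2 fun ω h1 h2 => hne ?_
    exact h1.2.symm.trans h2.2
  rw [hU, integral_iUnion_fintype (fun i => hm _ (hGi i)) hdisj (fun i => hgint.integrableOn),
    integral_iUnion_fintype (fun i => hm _ (hGi i)) hdisj (fun i => hint.integrableOn)]
  refine Finset.sum_congr rfl fun i _ => ?_
  have h1 := map_restrict_eq_smul hm hX hκ (hGi i) (fun ω hω => hω.2)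
  have hae : AEStronglyMeasurable f ((μ.restrict (G ∩ j ⁻¹' {i})).map X) := by
    rw [h1]; exact (hf i).aestronglyMeasurable.smul_measure _
  calc ∫ ω in G ∩ j ⁻¹' {i}, (∫ e, f e ∂(κ (j ω))) ∂μ
      = ∫ ω in G ∩ j ⁻¹' {i}, (∫ e, f e ∂(κ i)) ∂μ :=
        setIntegral_congr_fun (hm _ (hGi i)) fun ω hω => by
          have : j ω = i := hω.2
          simp only [this]
    _ = ∫ e, f e ∂((μ.restrict (G ∩ j ⁻¹' {i})).map X) := by
        rw [h1, integral_smul_measure]; simp [Measure.real]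
    _ = _ := integral_map hX.aemeasurable hae

end ConditionalLaw

/-! ### Maxima of action values and the clipping error. -/

section MaxValue

variable {A : Type*} [Fintype A] [Nonempty A]

/-- The maximum of the action values `q`. -/
noncomputable def maxValue (q : A → ℝ) : ℝ :=
  Finset.univ.sup' Finset.univ_nonempty q

theorem le_maxValue (q : A → ℝ) (a : A) : q a ≤ maxValue q :=
  Finset.le_sup' q (Finset.mem_univ a)

theorem maxValue_le {q : A → ℝ} {c : ℝ} (h : ∀ a, q a ≤ c) : maxValue q ≤ c :=
  Finset.sup'_le _ _ fun a _ => h a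

theorem exists_eq_maxValue (q : A → ℝ) : ∃ a, q a = maxValue q :=
  let ⟨a, _, h⟩ := Finset.exists_mem_eq_sup' Finset.univ_nonempty q
  ⟨a, h.symm⟩

theorem abs_maxValue_sub_le {q q' : A → ℝ} {d : ℝ} (h : ∀ a, |q a - q' a| ≤ d) :
    |maxValue q - maxValue q'| ≤ d := by
  have h1 : maxValue q ≤ maxValue q' + d :=
    maxValue_le fun a => by linarith [(abs_le.1 (h a)).2, le_maxValue q' a]
  have h2 : maxValue q' ≤ maxValue q + d :=
    maxValue_le fun a => by linarith [(abs_le.1 (h a)).1, le_maxValue q a]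
  exact abs_le.2 ⟨by linarith, by linarith⟩

/-- Clipping with a maximizing candidate changes the maximal value by at most three times the
distance of the two tables. -/
theorem abs_clipped_sub_maxValue_le {qA qB : A → ℝ} {K : ℕ} {C : Finset A} {aK aStar : A} {d : ℝ}
    (hC : IsTopCandidates qB K C) (hmem : aK ∈ C) (hK : ∀ u ∈ C, qA u ≤ qA aK)
    (hStar : ∀ u, qA u ≤ qA aStar) (hd : ∀ a, |qA a - qB a| ≤ d) :
    |min (qB aK) (qA aStar) - maxValue qA| ≤ 3 * d := by
  have hstar : qA aStar = maxValue qA := le_antisymm (le_maxValue qA aStar) (maxValue_le hStar)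
  obtain ⟨b, hb⟩ := exists_eq_maxValue qA
  have hd0 : 0 ≤ d := (abs_nonneg _).trans (hd b)
  have hlow : maxValue qA - 3 * d ≤ qB aK := by
    obtain ⟨c, hc⟩ := exists_eq_maxValue qB
    have h1 : qB b ≤ qB c := by rw [hc]; exact le_maxValue qB b
    have h2 := abs_le.1 (hd b)
    have h3 := abs_le.1 (hd c)
    have h4 := abs_le.1 (hd aK)
    -- If the maximizer `c` of `qB` is a candidate, the chain `aK`, `c`, `b` switches between the
    -- tables three times, each costing `d`. Otherwise `aK`, being a top candidate, satisfies `qB c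
    -- ≤ qB aK`, and one switch at `b` suffices.
    by_cases hcC : c ∈ C
    · have := hK c hcC
      linarith
    · have := hC.2 aK hmem c hcC
      linarith
  rw [hstar, abs_le]
  constructor
  · have : maxValue qA - 3 * d ≤ min (qB aK) (maxValue qA) := le_min hlow (by linarith)
    linarith
  · linarith [min_le_right (qB aK) (maxValue qA)]

end MaxValue

/-! ### The Bellman operator and its fixed point. -/

namespace MDP

variable {S A : Type*} [MeasurableSpace S] (M : MDP S A)

theorem transition_nonneg (s : S) (a : A) (s' : S) : 0 ≤ M.transition s a s' :=
  measureReal_nonneg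

variable [Fintype S]

theorem sum_transition [MeasurableSingletonClass S] (s : S) (a : A) : ∑ s', M.transition s a s' = 1 := by
  have := M.isProbabilityMeasure_law s a
  have h := sum_measureReal_preimage_singleton (μ := M.law s a) (f := Prod.snd) Finset.univ
    (fun y _ => measurable_snd (measurableSet_singleton y))
  simpa [transition, Set.preimage] using h

variable [Fintype A] [Nonempty A]

/-- The Bellman optimality operator. -/
noncomputable def bellman (γ : ℝ) (Q : S → A → ℝ) (s : S) (a : A) : ℝ :=
  M.reward s a + γ * ∑ s', M.transition s a s' * maxValue (Q s')

theorem isOptimalQ_iff {γ : ℝ} {Q : S → A → ℝ} :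
    M.IsOptimalQ γ Q ↔ Function.IsFixedPt (M.bellman γ) Q := by
  simp only [IsOptimalQ, Function.IsFixedPt, funext_iff, bellman, maxValue]
  exact forall₂_congr fun _ _ => eq_comm

variable [MeasurableSingletonClass S]

theorem abs_bellman_sub_le {γ : ℝ} (hγ : 0 ≤ γ) {Q Q' : S → A → ℝ} {d : ℝ}
    (h : ∀ s a, |Q s a - Q' s a| ≤ d) (s : S) (a : A) :
    |M.bellman γ Q s a - M.bellman γ Q' s a| ≤ γ * d := by
  have h1 : M.bellman γ Q s a - M.bellman γ Q' s a =
      γ * ∑ s', M.transition s a s' * (maxValue (Q s') - maxValue (Q' s')) := by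
    simp only [bellman, mul_sub, Finset.sum_sub_distrib]
    ring
  rw [h1, abs_mul, abs_of_nonneg hγ]
  refine mul_le_mul_of_nonneg_left ?_ hγ
  calc |∑ s', M.transition s a s' * (maxValue (Q s') - maxValue (Q' s'))|
      ≤ ∑ s', |M.transition s a s' * (maxValue (Q s') - maxValue (Q' s'))| :=
        Finset.abs_sum_le_sum_abs _ _
    _ ≤ ∑ s', M.transition s a s' * d := by
        refine Finset.sum_le_sum fun s' _ => ?_
        rw [abs_mul, abs_of_nonneg (M.transition_nonneg s a s')]
        exact mul_le_mul_of_nonneg_left (abs_maxValue_sub_le (h s')) (M.transition_nonneg s a s')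
    _ = d := by rw [← Finset.sum_mul, M.sum_transition, one_mul]

theorem contractingWith_bellman {γ : ℝ} (hγ0 : 0 ≤ γ) (hγ1 : γ < 1) :
    ContractingWith ⟨γ, hγ0⟩ (M.bellman γ) := by
  refine ⟨by exact_mod_cast hγ1, LipschitzWith.of_dist_le_mul fun Q Q' => ?_⟩
  have h : ∀ s a, |Q s a - Q' s a| ≤ dist Q Q' := fun s a =>
    (dist_le_pi_dist (Q s) (Q' s) a).trans (dist_le_pi_dist Q Q' s)
  have h0 : (0 : ℝ) ≤ γ * dist Q Q' := by positivity
  exact (dist_pi_le_iff h0).2 fun s => (dist_pi_le_iff h0).2 fun a =>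
    M.abs_bellman_sub_le hγ0 h s a

theorem exists_unique_isOptimalQ {γ : ℝ} (hγ0 : 0 ≤ γ) (hγ1 : γ < 1) :
    ∃ Q, M.IsOptimalQ γ Q ∧ ∀ Q', M.IsOptimalQ γ Q' → Q' = Q := by
  have h := M.contractingWith_bellman hγ0 hγ1
  refine ⟨ContractingWith.fixedPoint _ h, M.isOptimalQ_iff.2 h.fixedPoint_isFixedPt,
    fun Q' hQ' => h.fixedPoint_unique (M.isOptimalQ_iff.1 hQ')⟩

end MDP

/-! ### Greedy policies near the limit; evaluation at random indices. -/

/-- Policies that are greedy for tables close to `Q` are greedy for `Q`. -/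
theorem eventually_isGreedyPolicy_of_tendsto {S A : Type*} [Finite S] [Finite A]
    {q : ℕ → S → A → ℝ} {Q : S → A → ℝ}
    (h : ∀ x u, Tendsto (fun t => q t x u) atTop (𝓝 (Q x u))) :
    ∀ᶠ t in atTop, ∀ π : S → A, IsGreedyPolicy (q t) π → IsGreedyPolicy Q π := by
  -- Only finitely many strict inequalities of `Q` are involved, so eventually the tables satisfy
  -- all of them at once and rule out every suboptimal action.
  have h1 : ∀ x u v, ∀ᶠ t in atTop, Q x v < Q x u → q t x v < q t x u := by
    intro x u v
    by_cases hlt : Q x v < Q x u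
    · filter_upwards [(h x v).eventually_lt (h x u) hlt] with t ht _ using ht
    · exact .of_forall fun t hlt' => absurd hlt' hlt
  filter_upwards [eventually_all.2 fun x => eventually_all.2 fun u => eventually_all.2 (h1 x u)]
    with t ht π hπ x u
  by_contra! hlt
  exact (ht x u (π x) hlt).not_ge (hπ x u)

theorem measurable_apply_of_finite {Ω ι : Type*} {m : MeasurableSpace Ω} [Finite ι]
    [MeasurableSpace ι] [MeasurableSingletonClass ι] {F : Ω → ι → ℝ} {j : Ω → ι}
    (hF : ∀ i, Measurable fun ω => F ω i) (hj : Measurable j) :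
    Measurable fun ω => F ω (j ω) := by
  have h : Measurable fun p : Ω × ι => F p.1 p.2 := measurable_from_prod_countable_left hF
  exact h.comp (measurable_id.prodMk hj)

/-! ### Pathwise analysis along a fixed outcome. -/

namespace SimultaneousRun

variable {S A Ω : Type*} [MeasurableSpace S] [MeasurableSpace A] [mΩ : MeasurableSpace Ω]
  {M : MDP S A} {γ : ℝ} {μ : Measure Ω} (run : SimultaneousRun M γ μ)

/-- The conditions on the learning rates along the outcome `ω`. -/
structure ValidRates (ω : Ω) : Prop where
  mem_Icc : ∀ t x u, run.α t ω x u ∈ Set.Icc (0 : ℝ) 1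
  tendsto_sum : ∀ x u, Tendsto (fun n => ∑ t ∈ Finset.range n, run.α t ω x u) atTop atTop
  summable_sq : ∀ x u, Summable fun t => run.α t ω x u ^ 2
  eq_zero : ∀ t x u, (x, u) ≠ (run.s t ω, run.a t ω) → run.α t ω x u = 0

/-- The clipped estimate of the value of the next state that enters the target at time `t`. -/
noncomputable def clippedValue (t : ℕ) (ω : Ω) : ℝ :=
  min (run.QB t ω (run.s (t + 1) ω) (run.aK t ω)) (run.QA t ω (run.s (t + 1) ω) (run.aStar t ω))

theorem QA_succ {ω : Ω} (h : run.ValidRates ω) (t : ℕ) (x : S) (u : A) :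
    run.QA (t + 1) ω x u = (1 - run.α t ω x u) * run.QA t ω x u
      + run.α t ω x u * (run.r t ω + γ * run.clippedValue t ω) := by
  by_cases hi : (x, u) = (run.s t ω, run.a t ω)
  · obtain ⟨rfl, rfl⟩ := Prod.mk.inj hi
    rw [run.QA_update, clippedValue]
    ring
  · rw [run.QA_unchanged t ω x u hi, h.eq_zero t x u hi]
    ring

theorem QB_succ {ω : Ω} (h : run.ValidRates ω) (t : ℕ) (x : S) (u : A) :
    run.QB (t + 1) ω x u = (1 - run.α t ω x u) * run.QB t ω x u
      + run.α t ω x u * (run.r t ω + γ * run.clippedValue t ω) := by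
  by_cases hi : (x, u) = (run.s t ω, run.a t ω)
  · obtain ⟨rfl, rfl⟩ := Prod.mk.inj hi
    rw [run.QB_update, clippedValue]
    ring
  · rw [run.QB_unchanged t ω x u hi, h.eq_zero t x u hi]
    ring

theorem α_mul_visited {ω : Ω} (h : run.ValidRates ω) (f : S → A → ℝ)
    (t : ℕ) (x : S) (u : A) :
    run.α t ω x u * f (run.s t ω) (run.a t ω) = run.α t ω x u * f x u := by
  by_cases hi : (x, u) = (run.s t ω, run.a t ω)
  · obtain ⟨rfl, rfl⟩ := Prod.mk.inj hi
    rfl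
  · rw [h.eq_zero t x u hi, zero_mul, zero_mul]

/-- The difference of the two tables, indexed by state-action pairs. -/
noncomputable def tableDiff (ω : Ω) (t : ℕ) (i : S × A) : ℝ :=
  run.QA t ω i.1 i.2 - run.QB t ω i.1 i.2

/-- The deviation of the reward from its mean. -/
noncomputable def rewardNoise (ω : Ω) (t : ℕ) : ℝ :=
  run.r t ω - M.reward (run.s t ω) (run.a t ω)

variable {run} {ω : Ω}

theorem tendsto_tableDiff (h : run.ValidRates ω) :
    Tendsto (run.tableDiff ω) atTop (𝓝 0) := by
  refine tendsto_pi_nhds.2 fun i => ?_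
  refine tendsto_zero_of_averaging (b := fun _ => 0) (fun t => h.mem_Icc t i.1 i.2)
    (h.tendsto_sum i.1 i.2) (fun t => ?_) tendsto_const_nhds
  simp only [tableDiff, run.QA_succ h, run.QB_succ h]
  ring

variable [Fintype S] [Fintype A] [Nonempty A]

theorem abs_clippedValue_sub_le (t : ℕ) (ω : Ω) :
    |run.clippedValue t ω - maxValue (run.QA t ω (run.s (t + 1) ω))|
      ≤ 3 * ‖run.tableDiff ω t‖ :=
  abs_clipped_sub_maxValue_le (run.isTopCandidates t ω) (run.aK_mem t ω) (run.aK_max t ω)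
    (run.aStar_max t ω) fun a => norm_le_pi_norm (run.tableDiff ω t) (run.s (t + 1) ω, a)

/-- Boundedness comes before any control of the transition noise: the clipped value at the actual
next state is bounded by the norm of the tables, so only the reward noise must be averaged out. -/
theorem exists_abs_QA_le (hγ0 : 0 ≤ γ) (hγ1 : γ < 1) (h : run.ValidRates ω)
    (hr : ∀ x u, ∃ c, Tendsto
      (fun n => ∑ t ∈ Finset.range n, run.α t ω x u * run.rewardNoise ω t) atTop (𝓝 c)) :
    ∃ C, ∀ t x u, |run.QA t ω x u| ≤ C := by
  let R : S × A → ℝ := fun i => M.reward i.1 i.2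
  let W : ℕ → S × A → ℝ := fun t i =>
    averagedNoise (fun t => run.α t ω i.1 i.2) (run.rewardNoise ω) t
  let z : ℕ → S × A → ℝ := fun t i => run.QA t ω i.1 i.2 - W t i
  have hW : Tendsto W atTop (𝓝 0) := tendsto_pi_nhds.2 fun i =>
    tendsto_averagedNoise (fun t => h.mem_Icc t i.1 i.2) (h.tendsto_sum i.1 i.2) (hr i.1 i.2)
  have hQA : ∀ t x u, |run.QA t ω x u| ≤ ‖z t‖ + ‖W t‖ := fun t x u => by
    have h1 := norm_le_pi_norm (z t) (x, u)
    have h2 := norm_le_pi_norm (W t) (x, u)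
    calc |run.QA t ω x u| = ‖z t (x, u) + W t (x, u)‖ := by simp [z]
      _ ≤ _ := (norm_add_le _ _).trans (add_le_add h1 h2)
  -- This perturbation need not vanish, because the mean rewards stay in it; boundedness is all that
  -- is used.
  let δ : ℕ → ℝ := fun t => ‖R‖ + γ * (‖W t‖ + 3 * ‖run.tableDiff ω t‖)
  have hδ : Tendsto δ atTop (𝓝 (‖R‖ + γ * (‖(0 : S × A → ℝ)‖ + 3 * ‖(0 : S × A → ℝ)‖))) :=
    ((hW.norm.add ((tendsto_tableDiff h).norm.const_mul 3)).const_mul γ).const_add _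
  obtain ⟨B, hB⟩ := hδ.bddAbove_range
  have hW' : Tendsto (fun t => ‖W t‖) atTop (𝓝 ‖(0 : S × A → ℝ)‖) := hW.norm
  obtain ⟨B', hB'⟩ := hW'.bddAbove_range
  have hstep : ∀ t i, |z (t + 1) i| ≤ (1 - run.α t ω i.1 i.2) * |z t i|
      + run.α t ω i.1 i.2 * (γ * ‖z t‖ + δ t) := by
    intro t i
    have hα := h.mem_Icc t i.1 i.2
    have hrec : z (t + 1) i = (1 - run.α t ω i.1 i.2) * z t i
        + run.α t ω i.1 i.2 * (R i + γ * run.clippedValue t ω) := by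
      -- The noise is centered at the visited pair, while the recursion is at `i`. The two agree
      -- after multiplication by the step size, which is zero elsewhere.
      have hv := run.α_mul_visited h M.reward t i.1 i.2
      simp only [z, W, R, averagedNoise, rewardNoise, run.QA_succ h]
      linear_combination hv
    have hmax : |maxValue (run.QA t ω (run.s (t + 1) ω))| ≤ ‖z t‖ + ‖W t‖ := by
      obtain ⟨a, ha⟩ := exists_eq_maxValue (run.QA t ω (run.s (t + 1) ω))
      rw [← ha]
      exact hQA _ _ _
    have hclip : |run.clippedValue t ω| ≤ ‖z t‖ + (‖W t‖ + 3 * ‖run.tableDiff ω t‖) := by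
      have h1 := abs_le.1 (run.abs_clippedValue_sub_le t ω)
      have h2 := abs_le.1 hmax
      exact abs_le.2 ⟨by linarith, by linarith⟩
    have htarget : |R i + γ * run.clippedValue t ω| ≤ γ * ‖z t‖ + δ t := by
      calc |R i + γ * run.clippedValue t ω| ≤ |R i| + γ * |run.clippedValue t ω| := by
            refine (abs_add_le _ _).trans ?_
            rw [abs_mul, abs_of_nonneg hγ0]
        _ ≤ ‖R‖ + γ * (‖z t‖ + (‖W t‖ + 3 * ‖run.tableDiff ω t‖)) :=
            add_le_add (norm_le_pi_norm R i) (mul_le_mul_of_nonneg_left hclip hγ0)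
        _ = _ := by simp only [δ]; ring
    rw [hrec]
    refine (abs_add_le _ _).trans ?_
    rw [abs_mul, abs_mul, abs_of_nonneg hα.1, abs_of_nonneg (by linarith [hα.2])]
    exact add_le_add le_rfl (mul_le_mul_of_nonneg_left htarget hα.1)
  obtain ⟨C, hC⟩ := exists_norm_le_of_contraction (z := z) (α := fun t i => run.α t ω i.1 i.2)
    hγ1 (fun t i => h.mem_Icc t i.1 i.2) hstep hγ0 (fun t => hB (Set.mem_range_self t))
  exact ⟨C + B', fun t x u =>
    (hQA t x u).trans (add_le_add (hC t) (hB' (Set.mem_range_self t)))⟩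

/-- The deviation of the indicator of the next state `y` from the transition probability. -/
noncomputable def transitionNoise (run : SimultaneousRun M γ μ) (ω : Ω) (y : S) (t : ℕ) : ℝ :=
  ({y} : Set S).indicator 1 (run.s (t + 1) ω) - M.transition (run.s t ω) (run.a t ω) y

variable [MeasurableSingletonClass S]

/-- Once the averaged noise is removed, the error is averaged with a Bellman difference plus the
clipping bias. The former contracts by `γ`, up to the averaged noise, and the latter vanishes with
the table difference. -/
theorem tendsto_QA (hγ0 : 0 ≤ γ) (hγ1 : γ < 1) (h : run.ValidRates ω)
    (hr : ∀ x u, ∃ c, Tendsto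
      (fun n => ∑ t ∈ Finset.range n, run.α t ω x u * run.rewardNoise ω t) atTop (𝓝 c))
    (hs : ∀ x u y, ∃ c, Tendsto (fun n => ∑ t ∈ Finset.range n,
      run.α t ω x u * maxValue (run.QA t ω y) * run.transitionNoise ω y t) atTop (𝓝 c))
    {Q : S → A → ℝ} (hQ : M.IsOptimalQ γ Q) (x : S) (u : A) :
    Tendsto (fun t => run.QA t ω x u) atTop (𝓝 (Q x u)) := by
  let v : ℕ → S → ℝ := fun t y => maxValue (run.QA t ω y)
  let ξ : ℕ → ℝ := fun t => run.rewardNoise ω t + γ * ∑ y, v t y * run.transitionNoise ω y t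
  let U : ℕ → S × A → ℝ := fun t i => averagedNoise (fun t => run.α t ω i.1 i.2) ξ t
  let z : ℕ → S × A → ℝ := fun t i => run.QA t ω i.1 i.2 - U t i - Q i.1 i.2
  have hU : Tendsto U atTop (𝓝 0) := by
    refine tendsto_pi_nhds.2 fun i =>
      tendsto_averagedNoise (fun t => h.mem_Icc t i.1 i.2) (h.tendsto_sum i.1 i.2) ?_
    obtain ⟨c, hc⟩ := hr i.1 i.2
    choose d hd using hs i.1 i.2
    refine ⟨c + γ * ∑ y, d y,
      (hc.add ((tendsto_finsetSum _ fun y _ => hd y).const_mul γ)).congr fun n => ?_⟩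
    rw [Finset.sum_comm, Finset.mul_sum, ← Finset.sum_add_distrib]
    refine Finset.sum_congr rfl fun t _ => ?_
    simp only [ξ, v, Finset.mul_sum, mul_add]
    congr 1
    exact Finset.sum_congr rfl fun y _ => by ring
  let δ : ℕ → ℝ := fun t => γ * (‖U t‖ + 3 * ‖run.tableDiff ω t‖)
  have hδ : Tendsto δ atTop (𝓝 0) := by
    simpa using (hU.norm.add ((tendsto_tableDiff h).norm.const_mul 3)).const_mul γ
  have hz : Tendsto z atTop (𝓝 0) := by
    refine tendsto_zero_of_contraction (α := fun t i => run.α t ω i.1 i.2) (δ := δ) hγ1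
      (fun t i => h.mem_Icc t i.1 i.2) (fun i => h.tendsto_sum i.1 i.2) (fun t i => ?_) hγ0 hδ
    have hα := h.mem_Icc t i.1 i.2
    have hnoise : ∑ y, v t y * run.transitionNoise ω y t = v t (run.s (t + 1) ω)
        - ∑ y, M.transition (run.s t ω) (run.a t ω) y * v t y := by
      classical
      simp only [transitionNoise, mul_sub, Finset.sum_sub_distrib]
      congr 1
      · rw [Finset.sum_eq_single (run.s (t + 1) ω)]
        · simp
        · intro y _ hy
          simp [hy.symm]
        · simp
      · exact Finset.sum_congr rfl fun y _ => mul_comm _ _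
    have hrec : z (t + 1) i = (1 - run.α t ω i.1 i.2) * z t i + run.α t ω i.1 i.2 *
        (γ * (run.clippedValue t ω - v t (run.s (t + 1) ω))
          + (M.bellman γ (run.QA t ω) i.1 i.2 - M.bellman γ Q i.1 i.2)) := by
      have hv := run.α_mul_visited h (M.bellman γ (run.QA t ω)) t i.1 i.2
      have hQ' : M.bellman γ Q i.1 i.2 = Q i.1 i.2 :=
        congrFun (congrFun (M.isOptimalQ_iff.1 hQ) i.1) i.2
      have hb : M.bellman γ (run.QA t ω) (run.s t ω) (run.a t ω) =
        M.reward (run.s t ω) (run.a t ω)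
          + γ * ∑ y, M.transition (run.s t ω) (run.a t ω) y * v t y := rfl
      rw [hb] at hv
      simp only [z, U, ξ, averagedNoise, rewardNoise, run.QA_succ h, hnoise, hQ']
      linear_combination hv
    have hQA : ∀ x u, |run.QA t ω x u - Q x u| ≤ ‖z t‖ + ‖U t‖ := fun x u => by
      have h1 := norm_le_pi_norm (z t) (x, u)
      have h2 := norm_le_pi_norm (U t) (x, u)
      calc |run.QA t ω x u - Q x u| = ‖z t (x, u) + U t (x, u)‖ := by
            simp only [z, Real.norm_eq_abs]; congr 1; ring
        _ ≤ _ := (norm_add_le _ _).trans (add_le_add h1 h2)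
    have htarget : |γ * (run.clippedValue t ω - v t (run.s (t + 1) ω))
          + (M.bellman γ (run.QA t ω) i.1 i.2 - M.bellman γ Q i.1 i.2)|
        ≤ γ * ‖z t‖ + δ t := by
      refine (abs_add_le _ _).trans ?_
      rw [abs_mul, abs_of_nonneg hγ0]
      have h1 := mul_le_mul_of_nonneg_left (run.abs_clippedValue_sub_le t ω) hγ0
      have h2 := M.abs_bellman_sub_le hγ0 hQA i.1 i.2
      simp only [δ, v]
      linarith
    rw [hrec]
    refine (abs_add_le _ _).trans ?_
    rw [abs_mul, abs_mul, abs_of_nonneg hα.1, abs_of_nonneg (by linarith [hα.2])]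
    exact add_le_add le_rfl (mul_le_mul_of_nonneg_left htarget hα.1)
  have h1 := (tendsto_pi_nhds.1 hz (x, u)).add (tendsto_pi_nhds.1 hU (x, u))
  have h2 := h1.add_const (Q x u)
  simp only [Pi.zero_apply, zero_add] at h2
  refine h2.congr fun t => ?_
  simp only [z]
  ring

end SimultaneousRun

/-! ### Adaptedness of the tables and convergence of the noise series. -/

theorem measurable_maxValue {A Ω : Type*} [Fintype A] [Nonempty A] {m : MeasurableSpace Ω}
    {F : Ω → A → ℝ}
    (hF : ∀ a, Measurable fun ω => F ω a) : Measurable fun ω => maxValue (F ω) := by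
  have h := Finset.measurable_sup' (Finset.univ_nonempty (α := A)) (f := fun a ω => F ω a)
    fun a _ => hF a
  convert h using 1
  ext ω
  simp [maxValue]

namespace SimultaneousRun

variable {S A Ω : Type*} [Fintype S] [Fintype A]
  [MeasurableSpace S] [MeasurableSingletonClass S]
  [MeasurableSpace A] [MeasurableSingletonClass A] [mΩ : MeasurableSpace Ω]
  {M : MDP S A} {γ : ℝ} {μ : Measure Ω} (run : SimultaneousRun M γ μ)

theorem measurable_tables [Nonempty A] (t : ℕ) :
    (∀ x u, Measurable[run.ℱ t] fun ω => run.QA t ω x u) ∧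
      ∀ x u, Measurable[run.ℱ t] fun ω => run.QB t ω x u := by
  classical
  induction t with
  | zero => exact ⟨run.measurable_QA_zero, run.measurable_QB_zero⟩
  | succ t ih =>
    have hmono : run.ℱ t ≤ run.ℱ (t + 1) := run.ℱ.mono t.le_succ
    have hA : ∀ x u, Measurable[run.ℱ (t + 1)] fun ω => run.QA t ω x u := fun x u =>
      (ih.1 x u).mono hmono le_rfl
    have hB : ∀ x u, Measurable[run.ℱ (t + 1)] fun ω => run.QB t ω x u := fun x u =>
      (ih.2 x u).mono hmono le_rfl
    have hs := run.measurable_s (t + 1)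
    have hclip : Measurable[run.ℱ (t + 1)] (run.clippedValue t) := by
      have h1 : Measurable[run.ℱ (t + 1)] fun ω =>
          run.QB t ω (run.s (t + 1) ω) (run.aK t ω) :=
        measurable_apply_of_finite (F := fun ω u => run.QB t ω (run.s (t + 1) ω) u)
          (fun u => measurable_apply_of_finite (F := fun ω x => run.QB t ω x u)
            (fun x => hB x u) hs) (run.measurable_aK t)
      have h2 : Measurable[run.ℱ (t + 1)] fun ω =>
          maxValue (run.QA t ω (run.s (t + 1) ω)) :=
        measurable_maxValue fun u =>
          measurable_apply_of_finite (F := fun ω x => run.QA t ω x u) (fun x => hA x u) hs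
      -- No measurability of `aStar` is needed: the value of `QA` there is the maximum, which is
      -- measurable whatever the tie-breaking.
      convert h1.min h2 using 1
      ext ω
      rw [clippedValue]
      congr 1
      exact le_antisymm (le_maxValue _ _) (maxValue_le (run.aStar_max t ω))
    have hα : ∀ x u, Measurable[run.ℱ (t + 1)] fun ω => run.α t ω x u := fun x u =>
      (run.measurable_α t x u).mono hmono le_rfl
    have hsa : ∀ x u, MeasurableSet[run.ℱ (t + 1)] {ω | run.s t ω = x ∧ run.a t ω = u} :=
      fun x u => hmono _ ((run.measurable_s t (measurableSet_singleton x)).inter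
        (run.measurable_a t (measurableSet_singleton u)))
    have hr := run.measurable_r t
    constructor
    · intro x u
      have h : Measurable[run.ℱ (t + 1)] fun ω => if run.s t ω = x ∧ run.a t ω = u then
          run.QA t ω x u + run.α t ω x u *
            (run.r t ω + γ * run.clippedValue t ω - run.QA t ω x u) else run.QA t ω x u :=
        Measurable.ite (hsa x u) ((hA x u).add
          ((hα x u).mul ((hr.add (hclip.const_mul γ)).sub (hA x u)))) (hA x u)
      convert h using 1
      ext ω
      split_ifs with hi
      · obtain ⟨rfl, rfl⟩ := hi
        exact run.QA_update t ω
      · exact run.QA_unchanged t ω x u (by simpa [eq_comm] using hi)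
    · intro x u
      have h : Measurable[run.ℱ (t + 1)] fun ω => if run.s t ω = x ∧ run.a t ω = u then
          run.QB t ω x u + run.α t ω x u *
            (run.r t ω + γ * run.clippedValue t ω - run.QB t ω x u) else run.QB t ω x u :=
        Measurable.ite (hsa x u) ((hB x u).add
          ((hα x u).mul ((hr.add (hclip.const_mul γ)).sub (hB x u)))) (hB x u)
      convert h using 1
      ext ω
      split_ifs with hi
      · obtain ⟨rfl, rfl⟩ := hi
        exact run.QB_update t ω
      · exact run.QB_unchanged t ω x u (by simpa [eq_comm] using hi)

variable [IsProbabilityMeasure μ]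

/-- Weighted sums of centered functions of reward and next state converge almost surely. -/
theorem ae_exists_tendsto_sum_mul_centered {f : ℝ × S → ℝ} (hf : Measurable f)
    (hf2 : ∀ x u, MemLp f 2 (M.law x u)) {β : ℕ → Ω → ℝ}
    (hβm : ∀ t, Measurable[run.ℱ t] (β t)) (hβ : ∀ᵐ ω ∂μ, Summable fun t => β t ω ^ 2) :
    ∀ᵐ ω ∂μ, ∃ c, Tendsto (fun n => ∑ t ∈ Finset.range n, β t ω *
      (f (run.r t ω, run.s (t + 1) ω) - ∫ p, f p ∂(M.law (run.s t ω) (run.a t ω))))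
      atTop (𝓝 c) := by
  let κ : S × A → Measure (ℝ × S) := fun i => M.law i.1 i.2
  have : ∀ i, IsProbabilityMeasure (κ i) := fun i => M.isProbabilityMeasure_law i.1 i.2
  have hfκ : ∀ i, MemLp f 2 (κ i) := fun i => hf2 i.1 i.2
  let X : ℕ → Ω → ℝ × S := fun t ω => (run.r t ω, run.s (t + 1) ω)
  let j : ℕ → Ω → S × A := fun t ω => (run.s t ω, run.a t ω)
  have hXm : ∀ t, Measurable[run.ℱ (t + 1)] (X t) := fun t =>
    (run.measurable_r t).prodMk (run.measurable_s (t + 1))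
  have hX : ∀ t, Measurable (X t) := fun t => (hXm t).mono (run.ℱ.le _) le_rfl
  have hj : ∀ t, Measurable[run.ℱ t] (j t) := fun t =>
    (run.measurable_s t).prodMk (run.measurable_a t)
  have hκ : ∀ t, ∀ B, MeasurableSet B →
      μ[(X t ⁻¹' B).indicator (fun _ => (1 : ℝ)) | run.ℱ t]
        =ᵐ[μ] fun ω => (κ (j t ω)).real B := run.markov
  let e : S × A → ℝ := fun i => ∫ p, f p ∂(κ i)
  have hem : ∀ t, Measurable[run.ℱ t] fun ω => e (j t ω) := fun t =>
    (measurable_of_finite e).comp (hj t)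
  have hfint : ∀ i, Integrable f (κ i) := fun i => (hfκ i).integrable one_le_two
  have hfX : ∀ t, MemLp (fun ω => f (X t ω)) 2 μ := fun t =>
    (memLp_two_iff_integrable_sq (hf.comp (hX t)).aestronglyMeasurable).2
      (integrable_comp_of_conditionalLaw (f := fun p => f p ^ 2) (run.ℱ.le t) (hX t) (hj t)
        (hκ t) fun i => (hfκ i).integrable_sq)
  have heb : ∀ t ω, ‖e (j t ω)‖ ≤ ‖e‖ := fun t ω => norm_le_pi_norm e _
  have heL : ∀ t, MemLp (fun ω => e (j t ω)) 2 μ := fun t =>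
    MemLp.of_bound ((hem t).mono (run.ℱ.le t) le_rfl).aestronglyMeasurable ‖e‖
      (.of_forall (heb t))
  let ξ : ℕ → Ω → ℝ := fun t ω => f (X t ω) - e (j t ω)
  have hξ2 : ∀ t, MemLp (ξ t) 2 μ := fun t => (hfX t).sub (heL t)
  -- This dominates the squared centered variable by `(x - y)² ≤ 2x² + 2y²` and depends on reward
  -- and next state only. Its conditional mean takes finitely many values, and the sum of their
  -- absolute values is the uniform bound `C`.
  let g : ℝ × S → ℝ := fun p => 2 * f p ^ 2 + 2 * ‖e‖ ^ 2
  have hg : ∀ i, Integrable g (κ i) := fun i =>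
    ((hfκ i).integrable_sq.const_mul 2).add (integrable_const _)
  refine ae_exists_tendsto_sum_mul (ξ := ξ) (C := ∑ i, |∫ p, g p ∂(κ i)|) (fun t => ?_) hξ2
    (fun t => ?_) (fun t => ?_) hβm hβ
  · exact (hf.comp (hXm t)).sub ((hem t).mono (run.ℱ.mono t.le_succ) le_rfl)
  · have h1 := condExp_sub ((hfX t).integrable one_le_two) ((heL t).integrable one_le_two)
      (run.ℱ t)
    have h2 := condExp_comp_of_conditionalLaw (run.ℱ.le t) (hX t) (hj t) (hκ t) hfint
    have h3 := condExp_of_stronglyMeasurable (run.ℱ.le t) (hem t).stronglyMeasurable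
      ((heL t).integrable one_le_two)
    filter_upwards [h1, h2] with ω h1 h2
    refine h1.trans ?_
    rw [Pi.sub_apply, h2, h3]
    exact sub_self _
  · have h1 : μ[ξ t ^ 2 | run.ℱ t] ≤ᵐ[μ] μ[fun ω => g (X t ω) | run.ℱ t] := by
      refine condExp_mono (hξ2 t).integrable_sq
        (integrable_comp_of_conditionalLaw (run.ℱ.le t) (hX t) (hj t) (hκ t) hg)
        (.of_forall fun ω => ?_)
      have h2 : e (j t ω) ^ 2 ≤ ‖e‖ ^ 2 := sq_le_sq' (abs_le.1 (heb t ω)).1 (abs_le.1 (heb t ω)).2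
      simp only [ξ, g, Pi.pow_apply]
      nlinarith [sq_nonneg (f (X t ω) + e (j t ω))]
    filter_upwards [h1,
      condExp_comp_of_conditionalLaw (run.ℱ.le t) (hX t) (hj t) (hκ t) hg] with ω h1 h2
    rw [h2] at h1
    refine h1.trans ((le_abs_self _).trans ?_)
    exact Finset.single_le_sum (f := fun i => |∫ p, g p ∂(κ i)|) (fun i _ => abs_nonneg _)
      (Finset.mem_univ (j t ω))

theorem ae_rewardNoise_converges
    (hVar : ∀ x u, ProbabilityTheory.evariance Prod.fst (M.law x u) < ⊤)
    (h : ∀ᵐ ω ∂μ, run.ValidRates ω) :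
    ∀ᵐ ω ∂μ, ∀ x u, ∃ c, Tendsto
      (fun n => ∑ t ∈ Finset.range n, run.α t ω x u * run.rewardNoise ω t) atTop (𝓝 c) := by
  refine ae_all_iff.2 fun x => ae_all_iff.2 fun u => ?_
  refine run.ae_exists_tendsto_sum_mul_centered measurable_fst (fun y v => ?_)
    (fun t => run.measurable_α t x u) (h.mono fun ω hω => hω.summable_sq x u)
  have := M.isProbabilityMeasure_law y v
  exact (ProbabilityTheory.evariance_lt_top_iff_memLp
    measurable_fst.aestronglyMeasurable).1 (hVar y v)

/-- The bound on `QA` may depend on the outcome, since the martingale argument asks only for almost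
sure square summability of the predictable weights. -/
theorem ae_transitionNoise_converges [Nonempty A] (h : ∀ᵐ ω ∂μ, run.ValidRates ω)
    (hbdd : ∀ᵐ ω ∂μ, ∃ C, ∀ t x u, |run.QA t ω x u| ≤ C) :
    ∀ᵐ ω ∂μ, ∀ x u y, ∃ c, Tendsto (fun n => ∑ t ∈ Finset.range n,
      run.α t ω x u * maxValue (run.QA t ω y) * run.transitionNoise ω y t) atTop (𝓝 c) := by
  refine ae_all_iff.2 fun x => ae_all_iff.2 fun u => ae_all_iff.2 fun y => ?_
  have hset : MeasurableSet {p : ℝ × S | p.2 = y} :=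
    measurable_snd (measurableSet_singleton y)
  have hconv := run.ae_exists_tendsto_sum_mul_centered
    (f := {p : ℝ × S | p.2 = y}.indicator 1)
    (β := fun t ω => run.α t ω x u * maxValue (run.QA t ω y))
    (measurable_one.indicator hset)
    (fun x u => by
      have := M.isProbabilityMeasure_law x u
      exact (memLp_const (1 : ℝ)).indicator hset)
    (fun t => (run.measurable_α t x u).mul
      (measurable_maxValue fun a => (run.measurable_tables t).1 y a))
    (by
      filter_upwards [h, hbdd] with ω hω ⟨C, hC⟩
      refine Summable.of_nonneg_of_le (fun t => sq_nonneg _) (fun t => ?_)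
        ((hω.summable_sq x u).mul_right (C ^ 2))
      obtain ⟨a, ha⟩ := exists_eq_maxValue (run.QA t ω y)
      rw [mul_pow, ← ha]
      exact mul_le_mul_of_nonneg_left
        (sq_le_sq' (abs_le.1 (hC t y a)).1 (abs_le.1 (hC t y a)).2) (sq_nonneg _))
  filter_upwards [hconv] with ω hω
  simpa [integral_indicator_one hset] using! hω

end SimultaneousRun

/-! ### The convergence theorem. -/

theorem theorem4 {S A Ω : Type*} [Fintype S] [Fintype A] [Nonempty A]
    [MeasurableSpace S] [MeasurableSingletonClass S]
    [MeasurableSpace A] [MeasurableSingletonClass A]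
    [MeasurableSpace Ω] (μ : Measure Ω) [IsProbabilityMeasure μ]
    (M : MDP S A) (γ : ℝ) (hγ0 : 0 ≤ γ) (hγ1 : γ < 1)
    (hVar : ∀ x u, ProbabilityTheory.evariance Prod.fst (M.law x u) < ⊤)
    (run : SimultaneousRun M γ μ)
    (hVisit : ∀ᵐ ω ∂μ, ∀ x u, ∃ᶠ t in atTop, run.s t ω = x ∧ run.a t ω = u)
    (hα : ∀ᵐ ω ∂μ, ∀ t x u, run.α t ω x u ∈ Set.Icc (0 : ℝ) 1)
    (hα_sum : ∀ᵐ ω ∂μ, ∀ x u,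
      Tendsto (fun n => ∑ t ∈ Finset.range n, run.α t ω x u) atTop atTop)
    (hα_sq : ∀ᵐ ω ∂μ, ∀ x u, Summable (fun t => (run.α t ω x u) ^ 2))
    (hα_zero : ∀ᵐ ω ∂μ, ∀ t x u, (x, u) ≠ (run.s t ω, run.a t ω) → run.α t ω x u = 0) :
    ∃ Qstar : S → A → ℝ, M.IsOptimalQ γ Qstar ∧ (∀ Q, M.IsOptimalQ γ Q → Q = Qstar) ∧
      ∀ᵐ ω ∂μ,
        (∀ x u, Tendsto (fun t => run.QA t ω x u) atTop (𝓝 (Qstar x u))) ∧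
        (∀ x u, Tendsto (fun t => run.QB t ω x u) atTop (𝓝 (Qstar x u))) ∧
        ∀ᶠ t in atTop, ∀ π : S → A,
          (IsGreedyPolicy (run.QA t ω) π ∨ IsGreedyPolicy (run.QB t ω) π) →
            IsGreedyPolicy Qstar π := by
  obtain ⟨Q, hQ, huniq⟩ := M.exists_unique_isOptimalQ hγ0 hγ1
  refine ⟨Q, hQ, huniq, ?_⟩
  have hrates : ∀ᵐ ω ∂μ, run.ValidRates ω := by
    filter_upwards [hα, hα_sum, hα_sq, hα_zero] with ω h1 h2 h3 h4 using ⟨h1, h2, h3, h4⟩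
  have hr := run.ae_rewardNoise_converges hVar hrates
  have hbdd : ∀ᵐ ω ∂μ, ∃ C, ∀ t x u, |run.QA t ω x u| ≤ C := by
    filter_upwards [hrates, hr] with ω h1 h2
    exact SimultaneousRun.exists_abs_QA_le hγ0 hγ1 h1 h2
  filter_upwards [hrates, hr, run.ae_transitionNoise_converges hrates hbdd] with ω h1 h2 h3
  have hA : ∀ x u, Tendsto (fun t => run.QA t ω x u) atTop (𝓝 (Q x u)) := fun x u =>
    SimultaneousRun.tendsto_QA hγ0 hγ1 h1 h2 h3 hQ x u
  have hB : ∀ x u, Tendsto (fun t => run.QB t ω x u) atTop (𝓝 (Q x u)) := fun x u => by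
    have h := (hA x u).sub (tendsto_pi_nhds.1 (SimultaneousRun.tendsto_tableDiff h1) (x, u))
    simpa [SimultaneousRun.tableDiff] using h
  refine ⟨hA, hB, ?_⟩
  filter_upwards [eventually_isGreedyPolicy_of_tendsto hA,
    eventually_isGreedyPolicy_of_tendsto hB] with t h1 h2 π hπ
  exact hπ.elim (h1 π) (h2 π)
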